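/- For positive integers $n,k$ and $r\ge 1$, let $\mathrm{MP}_{n,r}^k$ be the set of permutations $\pi=\pi_1\cdots\pi_n$ of $\{1,\dots,n\}$ such that $\pi_i-i\equiv r-1 \pmod k$ for all $1\le i\le n$. Let $\mathrm{exc}(\pi)=|\{i:\pi_i>i\}|$, let $\mathcal A_n$ be the group of even permutations in the symmetric group $\mathfrak S_n$, and put $$\mathrm{MPE}_{n,r}^{k,+}(t)=\sum_{\pi\in \mathrm{MP}_{n,r}^k\cap\mathcal A_n}t^{\mathrm{exc}(\pi)},\qquad \mathrm{MPE}_{n,r}^{k,-}(t)=\sum_{\pi\in \mathrm{MP}_{n,r}^k\cap(\mathfrak S_n\setminus\mathcal A_n)}t^{\mathrm{exc}(\pi)}.$$ Let $f=\sum_i a_it^i\in\mathbb Q[t]$ be a nonzero polynomial of degree $d$, and let $s$ be the least exponent with $a_s\ne0$. The center of symmetry of $f$ is $(d+s)/2$. The polynomial $f$ is palindromic if $a_{s+i}=a_{d-i}$ for $0\le i\le\lfloor (d-s)/2\rfloor$. A palindromic $f$ is gamma-positive if $f(t)=\sum_{i=0}^{\lfloor (d-s)/2\rfloor}\gamma_i\,t^{s+i}(1+t)^{d-s-2i}$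 with all $\gamma_i\ge0$. **Theorem.** Let $n,k$ be positive integers with $n\equiv k\pmod{2k}$ and $n\ge5k$. Then $\mathrm{MPE}_{n,1}^{k,+}(t)$ and $\mathrm{MPE}_{n,1}^{k,-}(t)$ are gamma-positive with center of symmetry $(n-k)/2$. Moreover, for $2\le r\le k$, the polynomials $\mathrm{MPE}_{n,r}^{k,+}(t)$ and $\mathrm{MPE}_{n,r}^{k,-}(t)$ are gamma-positive with center of symmetry $(n+k)/2+1-r$. -/

import Mathlib

open Polynomial

/-- The number of excedances of a permutation, i.e. of indices `i` with `π_i > i`.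
The letters `1, …, n` are modelled by `Fin n = {0, …, n - 1}`; the shift by one affects neither
excedances, nor signs, nor differences `π_i - i`. -/
def exc {n : ℕ} (π : Equiv.Perm (Fin n)) : ℕ :=
  (Finset.univ.filter fun i : Fin n => i < π i).card

/-- Mod-`k`-alternating permutations of length `n` starting with the remainder `r` modulo `k`:
`π_i - i ≡ r - 1 (mod k)` for all `i`. -/
def MP (n k r : ℕ) : Finset (Equiv.Perm (Fin n)) :=
  Finset.univ.filter fun π =>
    ∀ i : Fin n, (((π i : Fin n) : ℕ) : ℤ) - ((i : ℕ) : ℤ) ≡ (r : ℤ) - 1 [ZMOD (k : ℤ)]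

open Classical in
/-- Excedance polynomial over the even permutations in `MP n k r`. -/
noncomputable def MPEplus (n k r : ℕ) : ℚ[X] :=
  ∑ π ∈ (MP n k r).filter (fun π => π ∈ alternatingGroup (Fin n)), X ^ exc π

open Classical in
/-- Excedance polynomial over the odd permutations in `MP n k r`. -/
noncomputable def MPEminus (n k r : ℕ) : ℚ[X] :=
  ∑ π ∈ (MP n k r).filter (fun π => π ∉ alternatingGroup (Fin n)), X ^ exc π

/-- The center of symmetry: the mean of the largest and the least exponent that occur. -/
noncomputable def centerOfSymmetry (f : ℚ[X]) : ℚ :=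
  ((f.natDegree : ℚ) + (f.natTrailingDegree : ℚ)) / 2

/-- A nonzero polynomial with degree `d` and least exponent `s` is palindromic if
`a_{s+i} = a_{d-i}` for `0 ≤ i ≤ ⌊(d - s)/2⌋`. -/
def IsPalindromic (f : ℚ[X]) : Prop :=
  f ≠ 0 ∧ ∀ i ≤ (f.natDegree - f.natTrailingDegree) / 2,
    f.coeff (f.natTrailingDegree + i) = f.coeff (f.natDegree - i)

/-- A palindromic polynomial with degree `d` and least exponent `s` is gamma-positive if its
coefficients in the expansion along `t^{s+i} (1+t)^{d-s-2i}`, `0 ≤ i ≤ ⌊(d - s)/2⌋`,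
are nonnegative. -/
def IsGammaPositive (f : ℚ[X]) : Prop :=
  IsPalindromic f ∧ ∃ γ : ℕ → ℚ, (∀ i, 0 ≤ γ i) ∧
    f = ∑ i ∈ Finset.range ((f.natDegree - f.natTrailingDegree) / 2 + 1),
      C (γ i) * X ^ (f.natTrailingDegree + i) *
        (1 + X) ^ (f.natDegree - f.natTrailingDegree - 2 * i)

/-! Put `q = n / k = 2m + 1` and `c = r - 1`. A permutation in `MP n k r` is a `k`-tuple of
permutations of `Fin q`, one per residue class of positions, followed by a shift of residues by `c`.
A class whose residue grows contributes weak excedances, any other class contributes excedances.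
Rotation turns weak excedances into excedances plus one, and it is even because `q` is odd. So the
plain and the signed sums over `MP` are `X^w A^k` and `± X^w (1 - X)^(2mk)`, where `A` is the
Eulerian polynomial of order `q` and `w` counts the growing residues (`sum_MP_twisted`).

Half the sum and half the difference must lie in the gamma cone. Put `P = (1 + X)^2 + 4X`. Since `(1
- X)^2 = (1 + X)^2 - 4X`, half of `P ± (1 - X)^2` is `(1 + X)^2` or `4X`. This property passes to
products (`half_mul_mem_gammaCone`), hence to `P^m`, then to `A`, because `A - P^m` is in the cone
for `m ≥ 2` (`eulerian_sub_mem_gammaCone`), and finally to `A^k`. -/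

/-! ### The gamma cone -/

/-- The cone of polynomials with a nonnegative expansion along `t^i (1+t)^j`, `2 i + j = N`. -/
noncomputable def gammaCone (N : ℕ) : AddSubmonoid ℚ[X] :=
  AddSubmonoid.closure {f | ∃ (a : ℚ) (i j : ℕ), 0 ≤ a ∧ 2 * i + j = N ∧
    f = C a * (X ^ i * (1 + X) ^ j)}

theorem term_mem_gammaCone {N : ℕ} {a : ℚ} (ha : 0 ≤ a) {i j : ℕ} (h : 2 * i + j = N) :
    C a * (X ^ i * (1 + X) ^ j) ∈ gammaCone N :=
  AddSubmonoid.subset_closure ⟨a, i, j, ha, h, rfl⟩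

theorem mul_mem_gammaCone {N M : ℕ} {f g : ℚ[X]} (hf : f ∈ gammaCone N) (hg : g ∈ gammaCone M) :
    f * g ∈ gammaCone (N + M) := by
  induction hf using AddSubmonoid.closure_induction with
  | zero => simp
  | add x y _ _ hx hy => rw [add_mul]; exact add_mem hx hy
  | mem x hx =>
    obtain ⟨a, i, j, ha, hij, rfl⟩ := hx
    induction hg using AddSubmonoid.closure_induction with
    | zero => simp
    | add x y _ _ hx hy => rw [mul_add]; exact add_mem hx hy
    | mem y hy =>
      obtain ⟨b, i', j', hb, hij', rfl⟩ := hy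
      convert term_mem_gammaCone (N := N + M) (mul_nonneg ha hb)
        (i := i + i') (j := j + j') (by omega) using 1
      rw [C_mul]; ring

theorem C_mul_mem_gammaCone {N : ℕ} {a : ℚ} (ha : 0 ≤ a) {f : ℚ[X]} (hf : f ∈ gammaCone N) :
    C a * f ∈ gammaCone N := by
  have h := mul_mem_gammaCone (term_mem_gammaCone (N := 0) ha (i := 0) (j := 0) rfl) hf
  simpa using h

theorem X_pow_mul_mem_gammaCone {N : ℕ} (w : ℕ) {f : ℚ[X]} (hf : f ∈ gammaCone N) :
    X ^ w * f ∈ gammaCone (2 * w + N) := by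
  have h := mul_mem_gammaCone
    (term_mem_gammaCone (N := 2 * w) zero_le_one (i := w) (j := 0) rfl) hf
  simpa using h

theorem exists_expansion_of_mem_gammaCone {N : ℕ} {f : ℚ[X]} (hf : f ∈ gammaCone N) :
    ∃ c : ℕ → ℚ, (∀ i, 0 ≤ c i) ∧
      f = ∑ i ∈ Finset.range (N / 2 + 1), C (c i) * (X ^ i * (1 + X) ^ (N - 2 * i)) := by
  induction hf using AddSubmonoid.closure_induction with
  | zero => exact ⟨0, by simp, by simp⟩
  | add x y _ _ hx hy =>
    obtain ⟨c, hc, rfl⟩ := hx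
    obtain ⟨d, hd, rfl⟩ := hy
    refine ⟨c + d, fun i => add_nonneg (hc i) (hd i), ?_⟩
    simp [add_mul, Finset.sum_add_distrib]
  | mem x hx =>
    obtain ⟨a, i, j, ha, hij, rfl⟩ := hx
    refine ⟨fun l => if l = i then a else 0, fun l => by dsimp only; split_ifs <;> simp [ha], ?_⟩
    rw [Finset.sum_eq_single i]
    · simp [← hij]
    · intro l _ hl; simp [hl]
    · intro h; exact absurd (Finset.mem_range.2 (by omega)) h

theorem coeff_gamma_term (i j l : ℕ) :
    (X ^ i * (1 + X) ^ j : ℚ[X]).coeff l = if i ≤ l then (j.choose (l - i) : ℚ) else 0 := by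
  rw [coeff_X_pow_mul', coeff_one_add_X_pow]

theorem coeff_eq_zero_of_mem_gammaCone {N : ℕ} {f : ℚ[X]} (hf : f ∈ gammaCone N) {l : ℕ}
    (hl : N < l) : f.coeff l = 0 := by
  induction hf using AddSubmonoid.closure_induction with
  | zero => simp
  | add x y _ _ hx hy => simp [hx, hy]
  | mem x hx =>
    obtain ⟨a, i, j, -, hij, rfl⟩ := hx
    rw [coeff_C_mul, coeff_gamma_term, if_pos (by omega), Nat.choose_eq_zero_of_lt (by omega)]
    simp

theorem coeff_symm_of_mem_gammaCone {N : ℕ} {f : ℚ[X]} (hf : f ∈ gammaCone N) {l : ℕ}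
    (hl : l ≤ N) : f.coeff (N - l) = f.coeff l := by
  induction hf using AddSubmonoid.closure_induction with
  | zero => simp
  | add x y _ _ hx hy => simp [hx, hy]
  | mem x hx =>
    obtain ⟨a, i, j, -, hij, rfl⟩ := hx
    simp only [coeff_C_mul, coeff_gamma_term]
    congr 1
    by_cases h1 : i ≤ l <;> by_cases h2 : i ≤ N - l
    · rw [if_pos h1, if_pos h2, show N - l - i = j - (l - i) by omega,
        Nat.choose_symm (by omega)]
    · rw [if_pos h1, if_neg h2, Nat.choose_eq_zero_of_lt (by omega)]; simp
    · rw [if_neg h1, if_pos h2, Nat.choose_eq_zero_of_lt (by omega)]; simp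
    · rw [if_neg h1, if_neg h2]

/-- The symmetry `l ↦ N - l` of the coefficients exchanges the extreme exponents. -/
theorem natDegree_add_natTrailingDegree_of_mem_gammaCone {N : ℕ} {f : ℚ[X]}
    (hf : f ∈ gammaCone N) (h0 : f ≠ 0) : f.natDegree + f.natTrailingDegree = N := by
  have hd : f.natDegree ≤ N := by
    by_contra! h
    exact leadingCoeff_ne_zero.2 h0 (coeff_eq_zero_of_mem_gammaCone hf h)
  have h1 : f.natTrailingDegree ≤ N - f.natDegree := by
    apply natTrailingDegree_le_of_ne_zero
    rw [coeff_symm_of_mem_gammaCone hf hd]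
    exact leadingCoeff_ne_zero.2 h0
  have h2 : N - f.natTrailingDegree ≤ f.natDegree := by
    apply le_natDegree_of_ne_zero
    rw [coeff_symm_of_mem_gammaCone hf ((natTrailingDegree_le_natDegree f).trans hd)]
    exact trailingCoeff_nonzero_iff_nonzero.2 h0
  omega

theorem isGammaPositive_of_mem_gammaCone {N : ℕ} {f : ℚ[X]} (hf : f ∈ gammaCone N) (h0 : f ≠ 0) :
    IsGammaPositive f ∧ centerOfSymmetry f = (N : ℚ) / 2 := by
  have hN := natDegree_add_natTrailingDegree_of_mem_gammaCone hf h0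
  have hle := natTrailingDegree_le_natDegree f
  set s := f.natTrailingDegree with hs
  set d := f.natDegree with hd
  refine ⟨⟨⟨h0, fun i hi => ?_⟩, ?_⟩, ?_⟩
  · rw [← hs, ← hd] at *
    rw [show d - i = N - (s + i) by omega, coeff_symm_of_mem_gammaCone hf (by omega)]
  · obtain ⟨c, hc, hfc⟩ := exists_expansion_of_mem_gammaCone hf
    refine ⟨fun i => c (s + i), fun i => hc _, ?_⟩
    -- The vanishing coefficient of `X^i` is a sum of nonnegative terms, one of which is `c i`.
    have hzero : ∀ i < s, c i = 0 := by
      intro i hi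
      have h := coeff_eq_zero_of_lt_natTrailingDegree (hs ▸ hi)
      rw [hfc, finsetSum_coeff, Finset.sum_eq_zero_iff_of_nonneg] at h
      · have := h i (Finset.mem_range.2 (by omega))
        simpa [coeff_C_mul, coeff_gamma_term] using this
      · intro l _
        rw [coeff_C_mul, coeff_gamma_term]
        exact mul_nonneg (hc l) (by split_ifs <;> positivity)
    rw [← hs, ← hd]
    calc f = _ := hfc
      _ = _ := by
        rw [show N / 2 + 1 = s + ((d - s) / 2 + 1) by omega, Finset.sum_range_add,
          Finset.sum_eq_zero, zero_add]
        · refine Finset.sum_congr rfl fun i _ => ?_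
          rw [show d - s - 2 * i = N - 2 * (s + i) by omega, mul_assoc]
        · intro i hi
          rw [hzero i (Finset.mem_range.1 hi)]; simp
  · rw [centerOfSymmetry, ← hN]; push_cast; rfl

/-! ### Half sums and half differences -/

theorem C_inv_two_mul_two : (C (2⁻¹ : ℚ) : ℚ[X]) * 2 = 1 := by
  rw [show (2 : ℚ[X]) = C 2 from rfl, ← C_mul]; norm_num

/-- If half the sum and half the difference of two polynomials lie in a cone, and likewise for two
further polynomials, then the same holds for the products. -/
theorem half_mul_mem_gammaCone {N M : ℕ} {a b a' b' : ℚ[X]}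
    (h : ∀ δ : ℤˣ, C (2⁻¹ : ℚ) * (a + (δ : ℤ) * b) ∈ gammaCone N)
    (h' : ∀ δ : ℤˣ, C (2⁻¹ : ℚ) * (a' + (δ : ℤ) * b') ∈ gammaCone M) (δ : ℤˣ) :
    C (2⁻¹ : ℚ) * (a * a' + (δ : ℤ) * (b * b')) ∈ gammaCone (N + M) := by
  -- `(a + b)(a' + δb') + (a - b)(a' - δb') = 2(aa' + δbb')`.
  have key := add_mem (mul_mem_gammaCone (h 1) (h' δ)) (mul_mem_gammaCone (h (-1)) (h' (-δ)))
  convert key using 1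
  push_cast
  linear_combination (-(C (2⁻¹ : ℚ)) * (a * a' + (δ : ℤ) * (b * b'))) * C_inv_two_mul_two

theorem half_pow_mem_gammaCone {N : ℕ} {a b : ℚ[X]}
    (h : ∀ δ : ℤˣ, C (2⁻¹ : ℚ) * (a + (δ : ℤ) * b) ∈ gammaCone N) (k : ℕ) (δ : ℤˣ) :
    C (2⁻¹ : ℚ) * (a ^ k + (δ : ℤ) * b ^ k) ∈ gammaCone (k * N) := by
  induction k generalizing δ with
  | zero =>
    rcases Int.units_eq_one_or δ with rfl | rfl
    · have := term_mem_gammaCone (N := 0) zero_le_one (i := 0) (j := 0) rfl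
      convert this using 1
      · simp
      · simp; linear_combination C_inv_two_mul_two
    · simp
  | succ k ih =>
    rw [pow_succ, pow_succ, add_one_mul]
    exact half_mul_mem_gammaCone ih h δ

/-! ### Plain and signed excedance polynomials -/

/-- The excedance polynomial of the symmetric group, twisted by a character of the sign. -/
noncomputable def twistedEulerian (χ : ℤˣ →* ℚ[X]) (n : ℕ) : ℚ[X] :=
  ∑ σ : Equiv.Perm (Fin n), χ (Equiv.Perm.sign σ) * X ^ exc σ

theorem exc_eq_sum {n : ℕ} (σ : Equiv.Perm (Fin n)) :
    exc σ = ∑ i, if i < σ i then 1 else 0 := by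
  rw [exc, Finset.card_filter]

theorem exc_decomposeFin_symm_zero {n : ℕ} (σ : Equiv.Perm (Fin n)) :
    exc (Equiv.Perm.decomposeFin.symm (0, σ)) = exc σ := by
  rw [exc_eq_sum, exc_eq_sum, Fin.sum_univ_succ]
  simp

/-- The new letter `0` is inserted into the arc `j → σ j`: `0 → σ j` is an excedance, `j → 0` is
not. -/
theorem exc_decomposeFin_symm_succ {n : ℕ} (σ : Equiv.Perm (Fin n)) (j : Fin n) :
    exc (Equiv.Perm.decomposeFin.symm ((σ j).succ, σ)) + (if j < σ j then 1 else 0)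
      = exc σ + 1 := by
  rw [exc_eq_sum, exc_eq_sum, Fin.sum_univ_succ, ← Finset.add_sum_erase _ _ (Finset.mem_univ j),
    ← Finset.add_sum_erase (a := j) Finset.univ (fun i => if i < σ i then 1 else 0)
      (Finset.mem_univ j)]
  have h : ∀ i ∈ Finset.univ.erase j,
      (if i.succ < Equiv.Perm.decomposeFin.symm ((σ j).succ, σ) i.succ then 1 else 0)
        = if i < σ i then 1 else 0 := by
    intro i hi
    have hij : σ i ≠ σ j := fun h => (Finset.ne_of_mem_erase hi) (σ.injective h)
    rw [Equiv.Perm.decomposeFin_symm_apply_succ, Equiv.swap_apply_of_ne_of_ne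
      (Fin.succ_ne_zero _) (fun h => hij (Fin.succ_injective _ h))]
    simp
  rw [Finset.sum_congr rfl h]
  simp
  ring

theorem sum_X_pow_exc_decomposeFin {n : ℕ} (σ : Equiv.Perm (Fin n)) :
    ∑ p : Fin n, (X : ℚ[X]) ^ exc (Equiv.Perm.decomposeFin.symm (p.succ, σ))
      = (n : ℚ[X]) * X * X ^ exc σ + X * (1 - X) * derivative (X ^ exc σ) := by
  rw [← Equiv.sum_comp σ]
  have h : ∀ j, (X : ℚ[X]) ^ exc (Equiv.Perm.decomposeFin.symm ((σ j).succ, σ))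
      = X * X ^ exc σ + (if j < σ j then 1 else 0) * ((1 - X) * X ^ exc σ) := by
    intro j
    have := exc_decomposeFin_symm_succ σ j
    split_ifs at this ⊢ with hj
    · rw [show exc (Equiv.Perm.decomposeFin.symm ((σ j).succ, σ)) = exc σ by omega]; ring
    · rw [show exc (Equiv.Perm.decomposeFin.symm ((σ j).succ, σ)) = exc σ + 1 by omega]; ring
  have hX : X * derivative ((X : ℚ[X]) ^ exc σ) = (exc σ : ℚ[X]) * X ^ exc σ := by
    rw [derivative_X_pow]
    rcases Nat.eq_zero_or_pos (exc σ) with h0 | h0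
    · simp [h0]
    · obtain ⟨e, he⟩ := Nat.exists_eq_succ_of_ne_zero h0.ne'
      rw [he]; simp; ring
  have hs : (∑ i : Fin n, if i < σ i then (1 : ℚ[X]) else 0) = (exc σ : ℚ[X]) := by
    rw [exc_eq_sum]; push_cast; rfl
  rw [Finset.sum_congr rfl fun j _ => h j, Finset.sum_add_distrib, ← Finset.sum_mul,
    ← Finset.sum_mul, hs, Finset.sum_const, Finset.card_univ, Fintype.card_fin, nsmul_eq_mul]
  linear_combination -(1 - X) * hX

theorem twistedEulerian_zero (χ : ℤˣ →* ℚ[X]) : twistedEulerian χ 0 = 1 := by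
  simp [twistedEulerian, exc]

/-- Either `0` is a new fixed point, or it is inserted into an arc by a transposition, which costs
the factor `χ (-1)`. -/
theorem twistedEulerian_succ (χ : ℤˣ →* ℚ[X]) (hχ : ∀ u, derivative (χ u) = 0) (n : ℕ) :
    twistedEulerian χ (n + 1) = twistedEulerian χ n + χ (-1) *
      ((n : ℚ[X]) * X * twistedEulerian χ n + X * (1 - X) * derivative (twistedEulerian χ n)) := by
  rw [twistedEulerian, ← Equiv.sum_comp Equiv.Perm.decomposeFin.symm, Fintype.sum_prod_type,
    Fin.sum_univ_succ]
  congr 1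
  · refine Finset.sum_congr rfl fun σ _ => ?_
    rw [exc_decomposeFin_symm_zero, Equiv.Perm.decomposeFin.symm_sign]
    simp
  · rw [Finset.sum_comm, twistedEulerian, derivative_sum, Finset.mul_sum, Finset.mul_sum,
      ← Finset.sum_add_distrib, Finset.mul_sum]
    refine Finset.sum_congr rfl fun σ _ => ?_
    have h := sum_X_pow_exc_decomposeFin σ
    simp only [Equiv.Perm.decomposeFin.symm_sign, Fin.succ_ne_zero, if_false, map_mul,
      ← Finset.mul_sum, derivative_mul, hχ, h]
    ring

/-- The character of the sign with values in the polynomials. -/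
noncomputable def signCharacter : ℤˣ →* ℚ[X] :=
  (Int.castRingHom ℚ[X] : ℤ →* ℚ[X]).comp (Units.coeHom ℤ)

theorem signCharacter_apply (u : ℤˣ) : signCharacter u = ((u : ℤ) : ℚ[X]) := rfl

theorem twistedEulerian_sign (n : ℕ) : twistedEulerian signCharacter (n + 1) = (1 - X) ^ n := by
  have hχ : ∀ u, derivative (signCharacter u) = 0 := fun u => derivative_intCast
  induction n with
  | zero => rw [twistedEulerian_succ _ hχ, twistedEulerian_zero]; simp
  | succ n ih =>
    rw [twistedEulerian_succ _ hχ, ih, signCharacter_apply]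
    rcases n with _ | n
    · simp; ring
    · simp [derivative_pow]; ring

/-! ### Eulerian polynomials of odd order in the cone -/

/-- The Eulerian polynomial, as the excedance polynomial of the symmetric group. -/
noncomputable abbrev eulerian (n : ℕ) : ℚ[X] := twistedEulerian 1 n

/-- The operator of the Eulerian recurrence. -/
noncomputable def eulerianStep (n : ℕ) (f : ℚ[X]) : ℚ[X] :=
  (1 + (n : ℚ[X]) * X) * f + X * (1 - X) * derivative f

theorem eulerian_succ (n : ℕ) : eulerian (n + 1) = eulerianStep n (eulerian n) := by
  rw [eulerian, twistedEulerian_succ _ (by simp), eulerianStep]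
  simp; ring

theorem eulerianStep_add (n : ℕ) (f g : ℚ[X]) :
    eulerianStep n (f + g) = eulerianStep n f + eulerianStep n g := by
  simp only [eulerianStep, derivative_add]; ring

theorem eulerianStep_C_mul (n : ℕ) (a : ℚ) (f : ℚ[X]) :
    eulerianStep n (C a * f) = C a * eulerianStep n f := by
  simp only [eulerianStep, derivative_C_mul]; ring

/-- At `j = 0` the truncated exponent `j - 1` is harmless, as its coefficient vanishes. -/
theorem eulerianStep_term (i j : ℕ) :
    eulerianStep (2 * i + j + 1) (X ^ i * (1 + X) ^ j) =
      C (i + 1 : ℚ) * (X ^ i * (1 + X) ^ (j + 1)) +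
        C (2 * j : ℚ) * (X ^ (i + 1) * (1 + X) ^ (j - 1)) := by
  rcases i with _ | i <;> rcases j with _ | j <;>
    simp [eulerianStep, derivative_pow, show (C 2 : ℚ[X]) = 2 from rfl] <;> ring

theorem eulerianStep_eulerianStep_term (i j : ℕ) :
    eulerianStep (2 * i + j + 2) (eulerianStep (2 * i + j + 1) (X ^ i * (1 + X) ^ j)) =
      C ((i + 1) ^ 2 : ℚ) * (X ^ i * (1 + X) ^ (j + 2)) +
      C (2 * (i + 1) * (j + 1) + 2 * j * (i + 2) : ℚ) * (X ^ (i + 1) * (1 + X) ^ j) +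
      C (4 * j * (j - 1) : ℚ) * (X ^ (i + 2) * (1 + X) ^ (j - 2)) := by
  rw [eulerianStep_term, eulerianStep_add, eulerianStep_C_mul, eulerianStep_C_mul,
    show 2 * i + j + 2 = 2 * i + (j + 1) + 1 by ring, eulerianStep_term]
  rcases j with _ | j
  · simp [show (C 2 : ℚ[X]) = 2 from rfl]; ring
  · rw [show 2 * i + (j + 1 + 1) + 1 = 2 * (i + 1) + (j + 1 - 1) + 1 by simp; ring,
      eulerianStep_term]
    simp only [Nat.add_sub_cancel, show j + 1 - 2 = j - 1 by omega]
    simp [show (C 2 : ℚ[X]) = 2 from rfl, show (C 4 : ℚ[X]) = 4 from rfl]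
    ring

/-- Two steps of the recurrence dominate multiplication by `P`. For `N = 0` the middle coefficient
would be `2 - 4 < 0`. -/
theorem eulerianStep_eulerianStep_sub_mem {N : ℕ} (hN : 0 < N) {f : ℚ[X]} (hf : f ∈ gammaCone N) :
    eulerianStep (N + 2) (eulerianStep (N + 1) f) - ((1 + X) ^ 2 + 4 * X) * f
      ∈ gammaCone (N + 2) := by
  induction hf using AddSubmonoid.closure_induction with
  | zero => simp [eulerianStep]
  | add x y _ _ hx hy =>
    rw [eulerianStep_add, eulerianStep_add, mul_add]
    convert add_mem hx hy using 1
    ring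
  | mem x hx =>
    obtain ⟨a, i, j, ha, rfl, rfl⟩ := hx
    rw [eulerianStep_C_mul, eulerianStep_C_mul, eulerianStep_eulerianStep_term]
    have hi : (0 : ℚ) ≤ i := by positivity
    have hj : (0 : ℚ) ≤ j := by positivity
    have h1 : C ((i + 1) ^ 2 - 1 : ℚ) * (X ^ i * (1 + X) ^ (j + 2)) ∈ gammaCone (2 * i + j + 2) :=
      term_mem_gammaCone (by nlinarith) (by ring)
    have h2 : C (2 * (i + 1) * (j + 1) + 2 * j * (i + 2) - 4 : ℚ) * (X ^ (i + 1) * (1 + X) ^ j)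
        ∈ gammaCone (2 * i + j + 2) := by
      refine term_mem_gammaCone ?_ (by ring)
      have : (1 : ℚ) ≤ i + j := by norm_cast; omega
      nlinarith [mul_nonneg hi hj]
    have h3 : C (4 * j * (j - 1) : ℚ) * (X ^ (i + 2) * (1 + X) ^ (j - 2))
        ∈ gammaCone (2 * i + j + 2) := by
      rcases lt_or_ge j 2 with h | h
      · have : (4 * j * (j - 1) : ℚ) = 0 := by interval_cases j <;> simp
        rw [this]; simp
      · have : (2 : ℚ) ≤ j := by exact_mod_cast h
        exact term_mem_gammaCone (by nlinarith) (by omega)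
    convert C_mul_mem_gammaCone ha (add_mem (add_mem h1 h2) h3) using 1
    simp only [C_sub, C_1, show (C 4 : ℚ[X]) = 4 from rfl]
    ring

theorem sq_add_mem_gammaCone : ((1 + X) ^ 2 + 4 * X : ℚ[X]) ∈ gammaCone 2 := by
  convert add_mem (term_mem_gammaCone (N := 2) zero_le_one (i := 0) (j := 2) rfl)
    (term_mem_gammaCone (N := 2) (a := 4) (by norm_num) (i := 1) (j := 0) rfl) using 1
  simp [show (C 4 : ℚ[X]) = 4 from rfl]

theorem pow_sq_add_mem_gammaCone (m : ℕ) :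
    ((1 + X) ^ 2 + 4 * X : ℚ[X]) ^ m ∈ gammaCone (2 * m) := by
  induction m with
  | zero => simpa using term_mem_gammaCone (N := 0) zero_le_one (i := 0) (j := 0) rfl
  | succ m ih => rw [pow_succ]; exact mul_mem_gammaCone ih sq_add_mem_gammaCone

theorem eulerian_five : eulerian 5 = 1 + 26 * X + 66 * X ^ 2 + 26 * X ^ 3 + X ^ 4 := by
  have h0 : eulerian 0 = 1 := twistedEulerian_zero 1
  have h1 : eulerian 1 = 1 := by rw [eulerian_succ, h0]; simp [eulerianStep]
  have h2 : eulerian 2 = 1 + X := by rw [eulerian_succ, h1]; simp [eulerianStep]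
  have h3 : eulerian 3 = 1 + 4 * X + X ^ 2 := by
    rw [eulerian_succ, h2]; simp [eulerianStep]; ring
  have h4 : eulerian 4 = 1 + 11 * X + 11 * X ^ 2 + X ^ 3 := by
    rw [eulerian_succ, h3]; simp [eulerianStep, derivative_pow]
    simp only [show (C 2 : ℚ[X]) = 2 from rfl]; ring
  rw [eulerian_succ, h4]; simp [eulerianStep, derivative_pow]
  simp only [show (C 2 : ℚ[X]) = 2 from rfl, show (C 3 : ℚ[X]) = 3 from rfl]; ring

/-- The bound on `m` is sharp among positive `m`: for `m = 1` the difference is `-2X`. -/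
theorem eulerian_sub_mem_gammaCone {m : ℕ} (hm : 2 ≤ m) :
    eulerian (2 * m + 1) - ((1 + X) ^ 2 + 4 * X) ^ m ∈ gammaCone (2 * m) := by
  induction m, hm using Nat.le_induction with
  | base =>
    -- The difference of order five is `14 X (1 + X)^2`.
    convert term_mem_gammaCone (N := 4) (a := 14) (by norm_num) (i := 1) (j := 2) rfl using 1
    rw [show 2 * 2 + 1 = 5 from rfl, eulerian_five]
    simp only [show (C 14 : ℚ[X]) = 14 from rfl]; ring
  | succ m hm ih =>
    have hA : eulerian (2 * m + 1) ∈ gammaCone (2 * m) := by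
      simpa using add_mem ih (pow_sq_add_mem_gammaCone m)
    have h1 := eulerianStep_eulerianStep_sub_mem (by omega) hA
    rw [← eulerian_succ, ← eulerian_succ] at h1
    rw [show 2 * (m + 1) + 1 = 2 * m + 2 + 1 by ring, show 2 * (m + 1) = 2 * m + 2 by ring]
    convert add_mem h1 (mul_mem_gammaCone ih sq_add_mem_gammaCone) using 1
    ring

theorem half_eulerian_mem_gammaCone {m : ℕ} (hm : 2 ≤ m) (δ : ℤˣ) :
    C (2⁻¹ : ℚ) * (eulerian (2 * m + 1) + ((δ : ℤ) : ℚ[X]) * (1 - X) ^ (2 * m))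
      ∈ gammaCone (2 * m) := by
  have hb : ∀ δ : ℤˣ, C (2⁻¹ : ℚ) * (((1 + X) ^ 2 + 4 * X) + ((δ : ℤ) : ℚ[X]) * (1 - X) ^ 2)
      ∈ gammaCone 2 := by
    intro δ
    rcases Int.units_eq_one_or δ with rfl | rfl
    · convert term_mem_gammaCone (N := 2) zero_le_one (i := 0) (j := 2) rfl using 1
      simp
      linear_combination (1 + X) ^ 2 * C_inv_two_mul_two
    · convert term_mem_gammaCone (N := 2) (a := 4) (by norm_num) (i := 1) (j := 0) rfl using 1
      simp [show (C 4 : ℚ[X]) = 4 from rfl]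
      linear_combination 4 * X * C_inv_two_mul_two
  have h := half_pow_mem_gammaCone hb m δ
  rw [mul_comm m 2] at h
  convert add_mem h (C_mul_mem_gammaCone (a := 2⁻¹) (by norm_num)
    (eulerian_sub_mem_gammaCone hm)) using 1
  rw [← pow_mul]; ring

theorem eval_one_eulerian_pos (n : ℕ) : 0 < (eulerian n).eval 1 := by
  simp [twistedEulerian, eval_finsetSum, Fintype.card_perm, Nat.factorial_pos]

/-! ### Weak excedances and rotation -/

/-- The number of weak excedances of a permutation. -/
def wexc {n : ℕ} (σ : Equiv.Perm (Fin n)) : ℕ :=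
  (Finset.univ.filter fun i : Fin n => i ≤ σ i).card

/-- `i ≤ σ i` means `i < σ i + 1`, except that the largest value wraps to `0`; its position is the
one weak excedance lost. -/
theorem wexc_eq_exc_mul_finRotate {n : ℕ} (σ : Equiv.Perm (Fin (n + 1))) :
    wexc σ = exc (finRotate (n + 1) * σ) + 1 := by
  have h : (Finset.univ.filter fun i : Fin (n + 1) => i ≤ σ i) =
      insert (σ⁻¹ (Fin.last n))
        (Finset.univ.filter fun i : Fin (n + 1) => i < (finRotate (n + 1) * σ) i) := by
    ext i
    rw [Finset.mem_insert, Finset.mem_filter, Finset.mem_filter, Equiv.Perm.eq_inv_iff_eq,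
      Equiv.Perm.mul_apply, Fin.lt_def, coe_finRotate, Fin.le_def]
    by_cases hi : σ i = Fin.last n
    · simp [hi, Nat.le_of_lt_succ i.2]
    · simp [hi]
  rw [wexc, h, Finset.card_insert_of_notMem, exc]
  rw [Finset.mem_filter, Fin.lt_def, Equiv.Perm.mul_apply, coe_finRotate]
  simp

theorem sum_X_pow_wexc (χ : ℤˣ →* ℚ[X]) (m : ℕ) :
    ∑ σ : Equiv.Perm (Fin (2 * m + 1)), χ (Equiv.Perm.sign σ) * X ^ wexc σ
      = X * twistedEulerian χ (2 * m + 1) := by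
  rw [twistedEulerian, ← Equiv.sum_comp (Equiv.mulLeft (finRotate (2 * m + 1)))
    (fun σ => χ (Equiv.Perm.sign σ) * X ^ exc σ), Finset.mul_sum]
  refine Finset.sum_congr rfl fun σ _ => ?_
  rw [wexc_eq_exc_mul_finRotate, Equiv.coe_mulLeft, Equiv.Perm.sign_mul, sign_finRotate]
  simp
  ring

/-! ### Block decomposition of `MP` -/

theorem exists_prodCongrLeft_eq {α β : Type*} (τ : Equiv.Perm (α × β))
    (h : ∀ p, (τ p).2 = p.2) : ∃ σ : β → Equiv.Perm α, Equiv.prodCongrLeft σ = τ := by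
  have h' : ∀ p, (τ.symm p).2 = p.2 := fun p => by
    rw [← h (τ.symm p), Equiv.apply_symm_apply]
  have e : ∀ x b, ((τ (x, b)).1, b) = τ (x, b) := fun x b => Prod.ext rfl (h (x, b)).symm
  have e' : ∀ x b, ((τ.symm (x, b)).1, b) = τ.symm (x, b) :=
    fun x b => Prod.ext rfl (h' (x, b)).symm
  refine ⟨fun b => ⟨fun x => (τ (x, b)).1, fun x => (τ.symm (x, b)).1, fun x => ?_, fun x => ?_⟩,
    ?_⟩
  · simp only [e, Equiv.symm_apply_apply]
  · simp only [e', Equiv.apply_symm_apply]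
  · ext1 ⟨x, b⟩
    exact e x b

/-- The shift of the residue by `c`. -/
def residueShift (q : ℕ) {k : ℕ} [NeZero k] (c : Fin k) : Equiv.Perm (Fin q × Fin k) :=
  Equiv.prodCongr (Equiv.refl _) (Equiv.addRight c)

/-- The permutation that acts on the positions of residue `a` by `σ a` and then shifts the
residue by `c`. -/
def blockPerm {q k : ℕ} [NeZero k] (c : Fin k) (σ : Fin k → Equiv.Perm (Fin q)) :
    Equiv.Perm (Fin (q * k)) :=
  finProdFinEquiv.permCongr ((Equiv.prodCongrLeft σ).trans (residueShift q c))

theorem blockPerm_apply {q k : ℕ} [NeZero k] (c : Fin k) (σ : Fin k → Equiv.Perm (Fin q))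
    (x : Fin q) (a : Fin k) :
    blockPerm c σ (finProdFinEquiv (x, a)) = finProdFinEquiv (σ a x, a + c) := by
  simp [blockPerm, residueShift, Equiv.permCongr_apply]

theorem sign_blockPerm {q k : ℕ} [NeZero k] (c : Fin k) (σ : Fin k → Equiv.Perm (Fin q)) :
    Equiv.Perm.sign (blockPerm c σ) =
      Equiv.Perm.sign (residueShift q c) * ∏ a, Equiv.Perm.sign (σ a) := by
  rw [blockPerm, Equiv.Perm.sign_permCongr, Equiv.Perm.sign_trans, Equiv.Perm.sign_prodCongrLeft]

theorem blockPerm_injective {q k : ℕ} [NeZero k] (c : Fin k) :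
    Function.Injective (blockPerm (q := q) c) := by
  intro σ τ h
  ext a x
  have := congrArg (fun π => finProdFinEquiv.symm (π (finProdFinEquiv (x, a)))) h
  simp only [blockPerm_apply, Equiv.symm_apply_apply, Prod.mk.injEq] at this
  rw [this.1]

theorem finProdFinEquiv_lt_iff {q k : ℕ} (x y : Fin q) (a b : Fin k) :
    finProdFinEquiv (x, a) < finProdFinEquiv (y, b) ↔ if a < b then x ≤ y else x < y := by
  rw [Fin.lt_def, finProdFinEquiv_apply_val, finProdFinEquiv_apply_val]
  have ha := a.2
  have hb := b.2
  simp only [Fin.lt_def, Fin.le_def]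
  rcases lt_trichotomy x.1 y.1 with h | h | h
  · have : k * (x.1 + 1) ≤ k * y.1 := Nat.mul_le_mul_left _ h
    rw [mul_add] at this
    split_ifs <;> constructor <;> intro <;> omega
  · rw [h]; split_ifs <;> constructor <;> intro <;> omega
  · have : k * (y.1 + 1) ≤ k * x.1 := Nat.mul_le_mul_left _ h
    rw [mul_add] at this
    split_ifs <;> constructor <;> intro <;> omega

/-- The order on `Fin (q * k)` is lexicographic in quotient and residue, so a growing residue makes
equal quotients count. -/
theorem exc_blockPerm {q k : ℕ} [NeZero k] (c : Fin k) (σ : Fin k → Equiv.Perm (Fin q)) :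
    exc (blockPerm c σ) = ∑ a, if a < a + c then wexc (σ a) else exc (σ a) := by
  rw [exc_eq_sum, ← Equiv.sum_comp finProdFinEquiv, Fintype.sum_prod_type_right]
  refine Finset.sum_congr rfl fun a _ => ?_
  simp only [blockPerm_apply, finProdFinEquiv_lt_iff]
  split_ifs
  · rw [wexc, Finset.card_filter]
  · rw [exc, Finset.card_filter]

theorem mem_MP_iff {q k : ℕ} [NeZero k] (c : Fin k) (π : Equiv.Perm (Fin (q * k))) :
    π ∈ MP (q * k) k (c + 1) ↔
      ∀ p, (finProdFinEquiv.symm (π (finProdFinEquiv p))).2 = p.2 + c := by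
  rw [MP, Finset.mem_filter]
  simp only [Finset.mem_univ, true_and]
  rw [← finProdFinEquiv.forall_congr_right]
  refine forall_congr' fun ⟨x, a⟩ => ?_
  obtain ⟨⟨y, b⟩, hyb⟩ := finProdFinEquiv.surjective (π (finProdFinEquiv (x, a)))
  rw [← hyb, Equiv.symm_apply_apply, finProdFinEquiv_apply_val, finProdFinEquiv_apply_val,
    Fin.ext_iff, Fin.val_add]
  have h1 : b.1 = (a.1 + c.1) % k ↔ b.1 ≡ a.1 + c.1 [MOD k] := by
    rw [Nat.ModEq, Nat.mod_eq_of_lt b.2]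
  rw [h1, ← Int.natCast_modEq_iff, Int.modEq_iff_dvd, Int.modEq_iff_dvd]
  push_cast
  -- The quotients change the difference of positions only by the multiple `k (y - x)`.
  rw [← dvd_add_left (dvd_mul_right (k : ℤ) (y.1 - x.1))]
  ring_nf

theorem MP_eq_map_blockPerm {q k : ℕ} [NeZero k] (c : Fin k) :
    MP (q * k) k (c + 1) = Finset.univ.map ⟨blockPerm (q := q) c, blockPerm_injective c⟩ := by
  ext π
  rw [mem_MP_iff, Finset.mem_map]
  constructor
  · intro h
    obtain ⟨σ, hσ⟩ := exists_prodCongrLeft_eq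
      ((finProdFinEquiv.symm.permCongr π).trans (residueShift q c).symm) (fun p => by
        change (finProdFinEquiv.symm (π (finProdFinEquiv p))).2 + -c = p.2
        rw [h p, add_neg_cancel_right])
    refine ⟨σ, Finset.mem_univ _, ?_⟩
    change blockPerm c σ = π
    rw [blockPerm, hσ]
    ext1 i
    simp only [Equiv.permCongr_apply, Equiv.trans_apply, Equiv.apply_symm_apply, Equiv.symm_symm]
  · rintro ⟨σ, -, rfl⟩ ⟨x, a⟩
    simp [blockPerm_apply]

theorem sum_MP_twisted {k : ℕ} [NeZero k] (χ : ℤˣ →* ℚ[X]) (m : ℕ) (c : Fin k) :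
    ∑ π ∈ MP ((2 * m + 1) * k) k (c + 1), χ (Equiv.Perm.sign π) * X ^ exc π =
      χ (Equiv.Perm.sign (residueShift (2 * m + 1) c)) *
        (X ^ (Finset.univ.filter fun a : Fin k => a < a + c).card *
          twistedEulerian χ (2 * m + 1) ^ k) := by
  have hblock : ∀ a : Fin k, (∑ σ : Equiv.Perm (Fin (2 * m + 1)), χ (Equiv.Perm.sign σ) *
      X ^ (if a < a + c then wexc σ else exc σ)) =
        (if a < a + c then X else 1) * twistedEulerian χ (2 * m + 1) := by
    intro a
    split_ifs
    · exact sum_X_pow_wexc χ m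
    · rw [one_mul, twistedEulerian]
  -- Expanding the product of the block sums gives the sum over all tuples `σ`.
  have hprod := Finset.prod_congr (rfl : (Finset.univ : Finset (Fin k)) = _) fun a _ => hblock a
  rw [Finset.prod_univ_sum, Fintype.piFinset_univ, Finset.prod_mul_distrib, Finset.prod_const,
    Finset.card_univ, Fintype.card_fin, Finset.prod_ite, Finset.prod_const, Finset.prod_const_one,
    mul_one] at hprod
  rw [MP_eq_map_blockPerm, Finset.sum_map, ← hprod, Finset.mul_sum]
  refine Finset.sum_congr rfl fun σ _ => ?_
  simp only [Function.Embedding.coeFn_mk]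
  rw [sign_blockPerm, exc_blockPerm, map_mul, map_prod, Finset.prod_mul_distrib,
    Finset.prod_pow_eq_pow_sum, mul_assoc]

/-- For `c ≠ 0` the residues that grow are those that do not wrap around. -/
theorem card_filter_lt_add {k : ℕ} [NeZero k] (c : Fin k) :
    (Finset.univ.filter fun a : Fin k => a < a + c).card = if c = 0 then 0 else k - c := by
  split_ifs with hc
  · simp [hc]
  · have hc0 : 0 < c.1 := Nat.pos_of_ne_zero fun h => hc (Fin.ext h)
    have hlt : ∀ a : Fin k, a < a + c ↔ a.1 < k - c := by
      intro a
      have ha := a.2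
      have hcl := c.2
      rw [Fin.lt_def, Fin.val_add]
      rcases lt_or_ge (a.1 + c.1) k with h | h
      · rw [Nat.mod_eq_of_lt h]; omega
      · rw [Nat.mod_eq_sub_mod h, Nat.mod_eq_of_lt (by omega)]; omega
    simp only [hlt]
    rw [Fin.card_filter_val_lt]
    exact min_eq_right (Nat.sub_le _ _)

/-! ### Separation by sign and conclusion -/

theorem half_sum_MP {n k r : ℕ} (δ : ℤˣ) :
    C (2⁻¹ : ℚ) * (∑ π ∈ MP n k r, (1 : ℤˣ →* ℚ[X]) (Equiv.Perm.sign π) * X ^ exc π +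
      ((δ : ℤ) : ℚ[X]) * ∑ π ∈ MP n k r, signCharacter (Equiv.Perm.sign π) * X ^ exc π) =
    ∑ π ∈ (MP n k r).filter (fun π => Equiv.Perm.sign π = δ), X ^ exc π := by
  rw [Finset.mul_sum, ← Finset.sum_add_distrib, Finset.mul_sum, Finset.sum_filter]
  refine Finset.sum_congr rfl fun π _ => ?_
  rw [signCharacter_apply, MonoidHom.one_apply]
  rcases Int.units_eq_one_or δ with rfl | rfl <;>
    rcases Int.units_eq_one_or (Equiv.Perm.sign π) with h | h <;> rw [h]
  · simp; linear_combination X ^ exc π * C_inv_two_mul_two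
  · simp
  · simp
  · simp; linear_combination X ^ exc π * C_inv_two_mul_two

theorem MPEplus_eq (n k r : ℕ) :
    MPEplus n k r = ∑ π ∈ (MP n k r).filter (fun π => Equiv.Perm.sign π = 1), X ^ exc π := by
  rw [MPEplus]
  refine Finset.sum_congr ?_ fun _ _ => rfl
  ext π
  simp [Equiv.Perm.mem_alternatingGroup]

theorem MPEminus_eq (n k r : ℕ) :
    MPEminus n k r = ∑ π ∈ (MP n k r).filter (fun π => Equiv.Perm.sign π = -1), X ^ exc π := by
  rw [MPEminus]
  refine Finset.sum_congr ?_ fun _ _ => rfl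
  ext π
  rcases Int.units_eq_one_or (Equiv.Perm.sign π) with h | h <;>
    simp [Equiv.Perm.mem_alternatingGroup, h]

theorem isGammaPositive_sum_MP {k : ℕ} [NeZero k] {m : ℕ} (hm : 2 ≤ m) (c : Fin k)
    (δ : ℤˣ) {f : ℚ[X]}
    (hf : f = ∑ π ∈ (MP ((2 * m + 1) * k) k (c + 1)).filter (fun π => Equiv.Perm.sign π = δ),
      X ^ exc π) :
    IsGammaPositive f ∧
      centerOfSymmetry f = ((if c = 0 then 0 else k - c : ℕ) : ℚ) + m * k := by
  -- The sign of the shift need not be computed: it only replaces `δ` by `δ * ε`, and the cone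
  -- statement covers both signs.
  set ε := Equiv.Perm.sign (residueShift (2 * m + 1) c)
  set w : ℕ := if c = 0 then 0 else k - c with hw
  have hf' : f = X ^ w * (C (2⁻¹ : ℚ) * (eulerian (2 * m + 1) ^ k +
      (((δ * ε : ℤˣ) : ℤ) : ℚ[X]) * ((1 - X) ^ (2 * m)) ^ k)) := by
    rw [hf, ← half_sum_MP, sum_MP_twisted, sum_MP_twisted, twistedEulerian_sign,
      card_filter_lt_add, ← hw, signCharacter_apply, MonoidHom.one_apply]
    push_cast
    ring
  have hmem := X_pow_mul_mem_gammaCone w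
    (half_pow_mem_gammaCone (half_eulerian_mem_gammaCone hm) k (δ * ε))
  rw [← hf'] at hmem
  -- At `1` the power of `1 - X` vanishes and the Eulerian part is positive.
  have h0 : f ≠ 0 := by
    intro h
    have h1 : f.eval 1 = 0 := by rw [h, eval_zero]
    have hpos := pow_pos (eval_one_eulerian_pos (2 * m + 1)) k
    rw [hf'] at h1
    simp [NeZero.ne k, show m ≠ 0 by omega] at h1
    exact hpos.ne' (by simp [h1, NeZero.ne k])
  obtain ⟨h1, h2⟩ := isGammaPositive_of_mem_gammaCone hmem h0
  refine ⟨h1, h2.trans ?_⟩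
  push_cast
  ring

theorem mainTheorem4 (n k : ℕ) (hk : 0 < k) (hnk : n ≡ k [MOD 2 * k]) (hn : 5 * k ≤ n) :
    ((IsGammaPositive (MPEplus n k 1) ∧
        centerOfSymmetry (MPEplus n k 1) = ((n : ℚ) - (k : ℚ)) / 2) ∧
      (IsGammaPositive (MPEminus n k 1) ∧
        centerOfSymmetry (MPEminus n k 1) = ((n : ℚ) - (k : ℚ)) / 2)) ∧
    ∀ r : ℕ, 2 ≤ r → r ≤ k →
      ((IsGammaPositive (MPEplus n k r) ∧
          centerOfSymmetry (MPEplus n k r) = ((n : ℚ) + (k : ℚ)) / 2 + 1 - (r : ℚ)) ∧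
        (IsGammaPositive (MPEminus n k r) ∧
          centerOfSymmetry (MPEminus n k r) = ((n : ℚ) + (k : ℚ)) / 2 + 1 - (r : ℚ))) := by
  have : NeZero k := ⟨hk.ne'⟩
  obtain ⟨m, hm⟩ := (Nat.modEq_iff_dvd' (show k ≤ n by omega)).1 hnk.symm
  obtain rfl : n = (2 * m + 1) * k := by
    have : (2 * m + 1) * k = 2 * k * m + k := by ring
    omega
  have hm2 : 2 ≤ m := by
    have := Nat.le_of_mul_le_mul_right hn hk
    omega
  constructor
  · have hc : (((2 * m + 1) * k : ℕ) - (k : ℚ)) / 2 =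
        ((if (0 : Fin k) = 0 then 0 else k - (0 : Fin k) : ℕ) : ℚ) + m * k := by
      rw [if_pos rfl]; push_cast; ring
    rw [hc]
    exact ⟨isGammaPositive_sum_MP hm2 0 1 (by rw [MPEplus_eq]; simp),
      isGammaPositive_sum_MP hm2 0 (-1) (by rw [MPEminus_eq]; simp)⟩
  · intro r hr hrk
    obtain ⟨c, rfl⟩ : ∃ c, r = c + 1 := ⟨r - 1, by omega⟩
    have hc : (((2 * m + 1) * k : ℕ) + (k : ℚ)) / 2 + 1 - ((c + 1 : ℕ) : ℚ) =
        ((if (⟨c, hrk⟩ : Fin k) = 0 then 0 else k - (⟨c, hrk⟩ : Fin k) : ℕ) : ℚ) + m * k := by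
      rw [if_neg (fun h => by have := congrArg Fin.val h; simp at this; omega),
        Nat.cast_sub (by simp; omega)]
      push_cast; ring
    rw [hc]
    exact ⟨isGammaPositive_sum_MP hm2 ⟨c, hrk⟩ 1 (MPEplus_eq _ _ _),
      isGammaPositive_sum_MP hm2 ⟨c, hrk⟩ (-1) (MPEminus_eq _ _ _)⟩
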